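/- Let $n,N,K\in\mathbb N$, $S=\{1,\dots,N\}$, $\mathcal K=\{1,\dots,K\}$, let $A_i\in\mathbb R^{n\times n}$ for $i\in S$, and let $C_1,\dots,C_K\subseteq\mathbb R^n$ be pairwise disjoint Borel sets with $C_1\cup\dots\cup C_K=\mathbb R^n$. For $\kappa\in\mathcal K$ and $i,j\in S$ let $\lambda^\kappa_{ij}\in\mathbb R$ with $\lambda^\kappa_{ij}\ge 0$ for $i\ne j$ and $\lambda^\kappa_{ii}=-\sum_{j\ne i}\lambda^\kappa_{ij}$. A realization of the state-dependent jump linear system with initial state $x_0\in\mathbb R^n$ and initial mode $i_0\in S$, on a probability space $(\Omega,\mathcal F,\Pr)$, is a pair of processes $x(t)\in\mathbb R^n$, $\theta(t)\in S$, $t\ge 0$, such that * almost surely $x(0)=x_0$, $\theta(0)=i_0$, the path of $\theta$ is right-continuous with left limits (so it is piecewise constant, with finitely many jumps in bounded time), and $x$ is continuous and satisfies $\dot x(t)=A_{\theta(t)}x(t)$ for all $t\ge 0$ (with the right derivative); * if $\sigma_t\in\mathcal K$ denotes the index of the set $C_\kappa$ that contains $x(t)$, then $\theta$ has the transition rates $\lambda^{\sigma_t}_{ij}$: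 for $i\ne j$, almost surely on $\{\theta(t)=i\}$, $$\Pr\{\theta(t+h)=j\mid \theta(t),x(t)\}=\mathbb E\Big[\int_t^{t+h}\lambda^{\sigma_s}_{ij}\,ds\ \Big|\ \theta(t),x(t)\Big]+o(h),\qquad h\downarrow 0,$$ with a deterministic error $o(h)$ that is uniform for $t$ in bounded intervals. (As long as $x$ stays in $C_\kappa$ during $[t,t+h]$, the integral equals $\lambda^\kappa_{ij}h$.) The system is called stochastically stable if $\mathbb E\big[\int_0^\infty\|x(t)\|^2\,dt\big]<\infty$ for every $x_0\in\mathbb R^n$, every $i_0\in S$ and every realization with this initial state and mode. **Theorem.** If there exist symmetric positive definite matrices $P_i\succ0$ and $W_{\kappa i}\succ 0$ ($i\in S$, $\kappa\in\mathcal K$) such that $$A_i^{T}P_i+P_iA_i+\sum_{j=1}^N\lambda^\kappa_{ij}P_j=-W_{\kappa i}\qquad\text{for all } i\in S,\ \kappa\in\mathcal K,$$ then the system is stochastically stable. -/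

import Mathlib

open MeasureTheory ProbabilityTheory Set Filter
open scoped Topology

/-- The data of a state-dependent jump linear system on `ℝⁿ` with modes `Fin N` and a partition
of `ℝⁿ` into the regions `C κ`, `κ : Fin K`. While the state is in `C κ`, the mode switches from
`i` to `j ≠ i` with rate `rate κ i j`. -/
structure SDJLS (n N K : ℕ) where
  /-- The system matrices `A_i`. -/
  A : Fin N → Matrix (Fin n) (Fin n) ℝ
  /-- The regions `C_κ`. -/
  C : Fin K → Set (EuclideanSpace ℝ (Fin n))
  measurableSet_C : ∀ κ, MeasurableSet (C κ)
  iUnion_C : ⋃ κ, C κ = univ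
  disjoint_C : ∀ κ κ', κ ≠ κ' → C κ ∩ C κ' = ∅
  /-- The transition rates `λ^κ_{ij}`. -/
  rate : Fin K → Fin N → Fin N → ℝ
  rate_nonneg : ∀ κ i j, i ≠ j → 0 ≤ rate κ i j
  rate_diag : ∀ κ i, rate κ i i = -∑ j ∈ Finset.univ.erase i, rate κ i j

namespace SDJLS

variable {n N K : ℕ}

theorem exists_mem_C (S : SDJLS n N K) (x : EuclideanSpace ℝ (Fin n)) : ∃ κ, x ∈ S.C κ := by
  have h : x ∈ ⋃ κ, S.C κ := by rw [S.iUnion_C]; exact mem_univ x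
  exact mem_iUnion.1 h

/-- The index `σ` of the region that contains the point `x`. -/
noncomputable def region (S : SDJLS n N K) (x : EuclideanSpace ℝ (Fin n)) : Fin K :=
  (S.exists_mem_C x).choose

theorem region_eq_iff (S : SDJLS n N K) (x : EuclideanSpace ℝ (Fin n)) (κ : Fin K) :
    S.region x = κ ↔ x ∈ S.C κ := by
  have hx : x ∈ S.C (S.region x) := (S.exists_mem_C x).choose_spec
  constructor
  · rintro rfl
    exact hx
  · intro h
    by_contra hne
    have hmem : x ∈ S.C (S.region x) ∩ S.C κ := ⟨hx, h⟩
    rw [S.disjoint_C _ _ hne] at hmem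
    exact hmem

end SDJLS

/-- A path with values in a finite set of modes is a jump path on `[0, ∞)`: it is right-continuous
and has left limits for the discrete topology, so it is piecewise constant with finitely many
jumps in every bounded time interval. -/
def IsJumpPath {N : ℕ} (r : ℝ → Fin N) : Prop :=
  (∀ t, 0 ≤ t → ∀ᶠ s in 𝓝[>] t, r s = r t) ∧
    (∀ t, 0 < t → ∃ i, ∀ᶠ s in 𝓝[<] t, r s = i)

namespace SDJLS

variable {n N K : ℕ}

/-- `x` solves `ẋ(t) = A_{r(t)} x(t)` on `[0, ∞)`: it is continuous, and the differential equation
holds at every `t ≥ 0` with the right derivative (at a jump time of the mode `r` the two one-sided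
derivatives of `x` differ in general, and `r` is right-continuous). -/
def IsSolution (S : SDJLS n N K) (r : ℝ → Fin N) (x : ℝ → EuclideanSpace ℝ (Fin n)) : Prop :=
  ContinuousOn x (Ici 0) ∧
    ∀ t, 0 ≤ t →
      HasDerivWithinAt x (Matrix.toEuclideanLin (S.A (r t)) (x t)) (Ici t) t

/-- The σ-algebra generated by `(x(t), θ(t))`. -/
abbrev sigmaAt {Ω : Type*} (x : ℝ → Ω → EuclideanSpace ℝ (Fin n)) (θ : ℝ → Ω → Fin N) (t : ℝ) :
    MeasurableSpace Ω :=
  MeasurableSpace.comap (fun ω => (x t ω, θ t ω)) inferInstance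

/-- The mode process `θ` has the transition rates `λ^{σ_t}_{ij}`, where `σ_t` is the index of the
region that contains `x(t)`: for `i ≠ j`, on the event `θ(t) = i`,
`Pr{θ(t+h) = j | θ(t), x(t)} = E[∫ s in t..t+h, λ^{σ_s}_{ij} | θ(t), x(t)] + o(h)` as `h ↓ 0`,
with a deterministic `o(h)` that is uniform for `t` in bounded intervals.
As long as `x` stays in `C_κ` during `[t, t+h]`, the integral is `λ^κ_{ij} h`. The integral is used
because at an instant at which `x` crosses the boundary between two regions the rate at the times
just after `t` need not be the rate that belongs to the point `x(t)`. -/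
def HasTransitionRates (S : SDJLS n N K) {Ω : Type*} [MeasurableSpace Ω] (P : Measure Ω)
    (x : ℝ → Ω → EuclideanSpace ℝ (Fin n)) (θ : ℝ → Ω → Fin N) : Prop :=
  ∀ i j, i ≠ j → ∀ T : ℝ, ∃ o : ℝ → ℝ, o =o[𝓝[>] 0] (fun h : ℝ => h) ∧
    ∀ t ∈ Icc 0 T, ∀ h, 0 < h → ∀ᵐ ω ∂P, θ t ω = i →
      |(P⟦{ω' | θ (t + h) ω' = j} | sigmaAt x θ t⟧) ω
        - (P[fun ω' => ∫ s in t..(t + h), S.rate (S.region (x s ω')) i j | sigmaAt x θ t]) ω|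
        ≤ o h

/-- `(x, θ)` is a realization, on the probability space `(Ω, P)`, of the state-dependent jump
linear system with initial state `x₀` and initial mode `i₀`. -/
structure IsRealization (S : SDJLS n N K) {Ω : Type*} [MeasurableSpace Ω] (P : Measure Ω)
    (x₀ : EuclideanSpace ℝ (Fin n)) (i₀ : Fin N)
    (x : ℝ → Ω → EuclideanSpace ℝ (Fin n)) (θ : ℝ → Ω → Fin N) : Prop where
  measurable_x : ∀ t, 0 ≤ t → Measurable (x t)
  measurable_θ : ∀ t, 0 ≤ t → Measurable (θ t)
  init_x : ∀ᵐ ω ∂P, x 0 ω = x₀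
  init_θ : ∀ᵐ ω ∂P, θ 0 ω = i₀
  jumpPath : ∀ᵐ ω ∂P, IsJumpPath (fun t => θ t ω)
  solution : ∀ᵐ ω ∂P, S.IsSolution (fun t => θ t ω) (fun t => x t ω)
  rates : S.HasTransitionRates P x θ

/-- Stochastic stability of the equilibrium `0` on the probability space `(Ω, P)`:
`E ∫₀^∞ ‖x(t)‖² dt < ∞` for every initial state and every initial mode. -/
def IsStochasticallyStable (S : SDJLS n N K) {Ω : Type*} [MeasurableSpace Ω]
    (P : Measure Ω) : Prop :=
  ∀ (x₀ : EuclideanSpace ℝ (Fin n)) (i₀ : Fin N)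
    (x : ℝ → Ω → EuclideanSpace ℝ (Fin n)) (θ : ℝ → Ω → Fin N),
    S.IsRealization P x₀ i₀ x θ →
      ∫⁻ ω, ∫⁻ t in Ici (0 : ℝ), ENNReal.ofReal (‖x t ω‖ ^ 2) ∂volume ∂P < ⊤

end SDJLS

/-!
The Lyapunov function is `V_i(x) = xᵀ P_i x`, and the matrix equation says that in mode `i` and
region `κ` the drift `xᵀ(A_iᵀP_i + P_iA_i)x + ∑ⱼ λ^κ_{ij} V_j(x)` equals `-xᵀ W_{κi} x`, which is
at most `-c V_i(x)` for some `c > 0`, since all the forms are positive definite and there are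
finitely many. The proof shows that the mean energy `φ(t) = E V_{θ(t)}(x(t))` satisfies
`φ(t) ≤ φ(0) exp(-c t)`. As `‖x‖²` is at most a multiple of `V_i(x)`, Tonelli's theorem then bounds
`E ∫ ‖x(t)‖² dt`.

The decay follows from Grönwall's inequality for right Dini derivatives, which needs two facts
about `φ`.

* Its upper right derivative is at most `-c φ` (`SDJLS.IsRealization.eventually_slope_meanEnergy_lt`).
  The increment over `[t, t + h]` is split into the motion of the state with the final mode and the
  change of the mode with the state frozen at `x(t)`. The first part is treated path by path:
  just after `t` the mode is constant, so the difference quotient converges, and solutions are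
  bounded and Lipschitz on bounded intervals with deterministic constants, so dominated convergence
  applies (`SDJLS.IsRealization.tendsto_integral_slope`). The second part is, by the transition rates
  and the pull-out property of conditional expectation, the integral of
  `∑ⱼ λ^{σ_s}_{θ(t) j} V_j(x(t))` over `s` in `[t, t + h]`, up to an `o(h)` uniform in `t`
  (`SDJLS.IsRealization.exists_isLittleO_mode_change`). The drift inequality holds for every region
  `σ_s`, so it does not matter how `x` crosses between the regions.
* It is continuous (`SDJLS.IsRealization.continuousOn_meanEnergy`). The uniformity of the `o(h)` is
  needed here, for continuity from the left.

Measurability on `Ω` is obtained from a jointly measurable process that agrees almost surely with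
`x`, because the paths of `x` are continuous only outside a null set.
-/

/-! ### Quadratic forms on Euclidean space -/

/-- The quadratic form `x ↦ xᵀ M x` of a square matrix, on Euclidean space. -/
noncomputable def quadForm {n : ℕ} (M : Matrix (Fin n) (Fin n) ℝ)
    (x : EuclideanSpace ℝ (Fin n)) : ℝ :=
  inner ℝ x (Matrix.toEuclideanLin M x)

section QuadForm

variable {n : ℕ}

theorem continuous_quadForm (M : Matrix (Fin n) (Fin n) ℝ) : Continuous (quadForm M) :=
  continuous_id.inner (LinearMap.continuous_of_finiteDimensional _)

theorem quadForm_smul_vec (M : Matrix (Fin n) (Fin n) ℝ) (c : ℝ)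
    (x : EuclideanSpace ℝ (Fin n)) : quadForm M (c • x) = c ^ 2 * quadForm M x := by
  simp only [quadForm, map_smul, inner_smul_left, inner_smul_right, conj_trivial]
  ring

theorem quadForm_zero_vec (M : Matrix (Fin n) (Fin n) ℝ) : quadForm M 0 = 0 := by
  simp [quadForm]

theorem quadForm_add (M M' : Matrix (Fin n) (Fin n) ℝ) (x : EuclideanSpace ℝ (Fin n)) :
    quadForm (M + M') x = quadForm M x + quadForm M' x := by
  simp only [quadForm, map_add, LinearMap.add_apply, inner_add_right]

theorem quadForm_neg (M : Matrix (Fin n) (Fin n) ℝ) (x : EuclideanSpace ℝ (Fin n)) :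
    quadForm (-M) x = -quadForm M x := by
  simp only [quadForm, map_neg, LinearMap.neg_apply, inner_neg_right]

theorem quadForm_sum_smul {ι : Type*} (s : Finset ι) (a : ι → ℝ)
    (M : ι → Matrix (Fin n) (Fin n) ℝ) (x : EuclideanSpace ℝ (Fin n)) :
    quadForm (∑ j ∈ s, a j • M j) x = ∑ j ∈ s, a j * quadForm (M j) x := by
  simp only [quadForm, map_sum, map_smul, LinearMap.sum_apply, LinearMap.smul_apply, inner_sum,
    inner_smul_right]

theorem quadForm_pos {M : Matrix (Fin n) (Fin n) ℝ} (hM : M.PosDef)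
    {x : EuclideanSpace ℝ (Fin n)} (hx : x ≠ 0) : 0 < quadForm M x := by
  have h0 : x.ofLp ≠ 0 := fun h => hx (by ext i; simpa using congrFun h i)
  have := hM.dotProduct_mulVec_pos h0
  rw [quadForm, EuclideanSpace.inner_eq_star_dotProduct, Matrix.ofLp_toLpLin, Matrix.toLin'_apply,
    dotProduct_comm]
  exact this

/-- A positive definite quadratic form is coercive, since it has a positive minimum on the
unit sphere. -/
theorem exists_pos_mul_norm_sq_le_quadForm {M : Matrix (Fin n) (Fin n) ℝ} (hM : M.PosDef) :
    ∃ c : ℝ, 0 < c ∧ ∀ x, c * ‖x‖ ^ 2 ≤ quadForm M x := by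
  obtain ⟨c, hc, h⟩ : ∃ c : ℝ, 0 < c ∧
      ∀ x ∈ Metric.sphere (0 : EuclideanSpace ℝ (Fin n)) 1, c ≤ quadForm M x := by
    rcases (Metric.sphere (0 : EuclideanSpace ℝ (Fin n)) 1).eq_empty_or_nonempty with he | hne
    · exact ⟨1, one_pos, by simp [he]⟩
    · obtain ⟨y, hy, hmin⟩ := (isCompact_sphere (0 : EuclideanSpace ℝ (Fin n)) 1).exists_isMinOn
        hne (continuous_quadForm M).continuousOn
      refine ⟨quadForm M y, quadForm_pos hM ?_, fun x hx => hmin hx⟩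
      rintro rfl
      simp at hy
  refine ⟨c, hc, fun x => ?_⟩
  rcases eq_or_ne x 0 with rfl | hx
  · simp [quadForm_zero_vec]
  · have hn : 0 < ‖x‖ := norm_pos_iff.2 hx
    have h1 := h (‖x‖⁻¹ • x) (by simp [norm_smul, hn.ne'])
    rw [quadForm_smul_vec, inv_pow, inv_mul_eq_div, le_div_iff₀ (by positivity)] at h1
    exact h1

theorem exists_pos_forall_mul_norm_sq_le_quadForm {ι : Type*} [Finite ι]
    {M : ι → Matrix (Fin n) (Fin n) ℝ} (hM : ∀ i, (M i).PosDef) :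
    ∃ c : ℝ, 0 < c ∧ ∀ i x, c * ‖x‖ ^ 2 ≤ quadForm (M i) x := by
  choose c hc h using fun i => exists_pos_mul_norm_sq_le_quadForm (hM i)
  rcases isEmpty_or_nonempty ι with he | hne
  · exact ⟨1, one_pos, fun i => he.elim i⟩
  · obtain ⟨i₀, h₀⟩ := Finite.exists_min c
    exact ⟨c i₀, hc i₀, fun i x =>
      (mul_le_mul_of_nonneg_right (h₀ i) (sq_nonneg _)).trans (h i x)⟩

theorem exists_forall_norm_toEuclideanLin_le {ι : Type*} [Finite ι]
    (M : ι → Matrix (Fin n) (Fin n) ℝ) :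
    ∃ C : ℝ, 0 ≤ C ∧ ∀ i x, ‖Matrix.toEuclideanLin (M i) x‖ ≤ C * ‖x‖ := by
  obtain ⟨C, hC⟩ := Finite.bddAbove_range
    fun i => ‖LinearMap.toContinuousLinearMap (Matrix.toEuclideanLin (M i))‖
  refine ⟨max C 0, le_max_right _ _, fun i x => ?_⟩
  refine ((LinearMap.toContinuousLinearMap (Matrix.toEuclideanLin (M i))).le_opNorm x).trans ?_
  gcongr
  exact (hC (mem_range_self i)).trans (le_max_left _ _)

theorem abs_quadForm_sub_le {M : Matrix (Fin n) (Fin n) ℝ} {C : ℝ}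
    (hC : ∀ x, ‖Matrix.toEuclideanLin M x‖ ≤ C * ‖x‖) (x y : EuclideanSpace ℝ (Fin n)) :
    |quadForm M x - quadForm M y| ≤ C * (‖x‖ + ‖y‖) * ‖x - y‖ := by
  have h : quadForm M x - quadForm M y =
      inner ℝ x (Matrix.toEuclideanLin M (x - y)) + inner ℝ (x - y) (Matrix.toEuclideanLin M y) := by
    simp only [quadForm, map_sub, inner_sub_left, inner_sub_right]
    ring
  rw [h]
  calc _ ≤ |inner ℝ x (Matrix.toEuclideanLin M (x - y))|
        + |inner ℝ (x - y) (Matrix.toEuclideanLin M y)| := abs_add_le _ _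
    _ ≤ ‖x‖ * (C * ‖x - y‖) + ‖x - y‖ * (C * ‖y‖) := by
      refine add_le_add ((abs_real_inner_le_norm _ _).trans ?_)
        ((abs_real_inner_le_norm _ _).trans ?_) <;> gcongr <;> exact hC _
    _ = _ := by ring

theorem abs_quadForm_le {M : Matrix (Fin n) (Fin n) ℝ} {C : ℝ}
    (hC : ∀ x, ‖Matrix.toEuclideanLin M x‖ ≤ C * ‖x‖) (x : EuclideanSpace ℝ (Fin n)) :
    |quadForm M x| ≤ C * ‖x‖ ^ 2 := by
  have h := abs_quadForm_sub_le hC x 0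
  simp only [quadForm_zero_vec, sub_zero, norm_zero, add_zero] at h
  linarith

/-- Along a solution of `ẋ = A x` the form of `P` has the derivative `xᵀ(AᵀP + PA)x`. -/
theorem HasDerivWithinAt.quadForm {A P : Matrix (Fin n) (Fin n) ℝ}
    {x : ℝ → EuclideanSpace ℝ (Fin n)} {s : Set ℝ} {t : ℝ}
    (hx : HasDerivWithinAt x (Matrix.toEuclideanLin A (x t)) s t) :
    HasDerivWithinAt (fun r => quadForm P (x r)) (quadForm (A.transpose * P + P * A) (x t)) s t := by
  have hP : HasDerivWithinAt (fun r => Matrix.toEuclideanLin P (x r))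
      (Matrix.toEuclideanLin P (Matrix.toEuclideanLin A (x t))) s t :=
    (LinearMap.toContinuousLinearMap (Matrix.toEuclideanLin P)).hasFDerivAt.comp_hasDerivWithinAt t
      hx
  refine (hx.inner ℝ hP).congr_deriv ?_
  have h1 : Matrix.toEuclideanLin (A.transpose * P) (x t) =
      LinearMap.adjoint (Matrix.toEuclideanLin A) (Matrix.toEuclideanLin P (x t)) := by
    rw [← Matrix.toEuclideanLin_conjTranspose_eq_adjoint, Matrix.conjTranspose_eq_transpose_of_trivial]
    simp [Matrix.toLpLin_apply]
  have h2 : Matrix.toEuclideanLin (P * A) (x t) =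
      Matrix.toEuclideanLin P (Matrix.toEuclideanLin A (x t)) := by
    simp [Matrix.toLpLin_apply]
  rw [quadForm_add, _root_.quadForm, _root_.quadForm, h1, h2, LinearMap.adjoint_inner_right]
  ring

end QuadForm

/-! ### Pathwise bounds -/

namespace SDJLS

variable {n N K : ℕ} {S : SDJLS n N K}

theorem IsSolution.norm_le {r : ℝ → Fin N} {x : ℝ → EuclideanSpace ℝ (Fin n)} {C : ℝ}
    (hx : S.IsSolution r x) (hC : ∀ i y, ‖Matrix.toEuclideanLin (S.A i) y‖ ≤ C * ‖y‖)
    {t : ℝ} (ht : 0 ≤ t) : ‖x t‖ ≤ ‖x 0‖ * Real.exp (C * t) := by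
  have h := norm_le_gronwallBound_of_norm_deriv_right_le (f := x) (a := 0) (b := t) (K := C)
    (ε := 0) (hx.1.mono Icc_subset_Ici_self) (fun s hs => hx.2 s hs.1) le_rfl
    (fun s _ => by simpa using hC (r s) (x s)) t ⟨ht, le_rfl⟩
  simpa [gronwallBound_ε0] using h

theorem IsSolution.norm_le_of_le {r : ℝ → Fin N} {x : ℝ → EuclideanSpace ℝ (Fin n)} {C : ℝ}
    (hx : S.IsSolution r x) (hC0 : 0 ≤ C)
    (hC : ∀ i y, ‖Matrix.toEuclideanLin (S.A i) y‖ ≤ C * ‖y‖)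
    {t T : ℝ} (ht : 0 ≤ t) (hT : t ≤ T) : ‖x t‖ ≤ ‖x 0‖ * Real.exp (C * T) :=
  (hx.norm_le hC ht).trans (by gcongr)

theorem IsSolution.norm_sub_le {r : ℝ → Fin N} {x : ℝ → EuclideanSpace ℝ (Fin n)} {C : ℝ}
    (hx : S.IsSolution r x) (hC0 : 0 ≤ C)
    (hC : ∀ i y, ‖Matrix.toEuclideanLin (S.A i) y‖ ≤ C * ‖y‖)
    {s t T : ℝ} (hs : 0 ≤ s) (hst : s ≤ t) (hT : t ≤ T) :
    ‖x t - x s‖ ≤ C * (‖x 0‖ * Real.exp (C * T)) * (t - s) := by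
  refine norm_image_sub_le_of_norm_deriv_right_le_segment (f := x) (a := s) (b := t)
    (hx.1.mono fun u hu => hs.trans hu.1) (fun u hu => hx.2 u (hs.trans hu.1)) (fun u hu => ?_)
    t ⟨hst, le_rfl⟩
  refine (hC _ _).trans ?_
  gcongr
  exact hx.norm_le_of_le hC0 hC (hs.trans hu.1) (hu.2.le.trans hT)

end SDJLS

/-! ### Measurability in time and chance -/

/-- A process that is measurable at each time and has almost surely continuous paths on `[0, ∞)`
agrees there almost surely with a jointly measurable process. -/
theorem exists_measurable_uncurry_of_continuousOn {Ω E : Type*} [MeasurableSpace Ω]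
    {P : Measure Ω} [TopologicalSpace E] [TopologicalSpace.PseudoMetrizableSpace E]
    [MeasurableSpace E] [BorelSpace E] [Inhabited E] {x : ℝ → Ω → E}
    (hm : ∀ t, 0 ≤ t → Measurable (x t)) (hc : ∀ᵐ ω ∂P, ContinuousOn (fun t => x t ω) (Ici 0)) :
    ∃ y : ℝ → Ω → E, Measurable (Function.uncurry y) ∧ ∀ᵐ ω ∂P, ∀ t, 0 ≤ t → x t ω = y t ω := by
  classical
  obtain ⟨B, hsub, hB, hB0⟩ := exists_measurable_superset_of_null (ae_iff.1 hc)
  have hgood : ∀ ω ∉ B, ContinuousOn (fun t => x t ω) (Ici 0) := fun ω hω => by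
    by_contra h
    exact hω (hsub h)
  refine ⟨fun t ω => if ω ∈ B then default else x (max t 0) ω, ?_, ?_⟩
  · refine measurable_uncurry_of_continuous_of_measurable (fun ω => ?_) (fun t => ?_)
    · by_cases hω : ω ∈ B
      · simp only [hω, if_true]
        exact continuous_const
      · simp only [hω, if_false]
        exact (hgood ω hω).comp_continuous (continuous_id.max continuous_const)
          fun t => le_max_right t 0
    · exact Measurable.ite hB measurable_const (hm _ (le_max_right _ _))
  · filter_upwards [compl_mem_ae_iff.2 hB0] with ω hω t ht
    rw [if_neg hω, max_eq_left ht]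

namespace SDJLS

variable {n N K : ℕ} (S : SDJLS n N K)

theorem measurable_rate_region (i j : Fin N) :
    Measurable fun x => S.rate (S.region x) i j := by
  have h : Measurable S.region := measurable_to_countable' fun κ => by
    have : S.region ⁻¹' {κ} = S.C κ := by
      ext x
      exact S.region_eq_iff x κ
    rw [this]
    exact S.measurableSet_C κ
  exact (measurable_of_countable fun κ => S.rate κ i j).comp h

theorem exists_forall_abs_rate_le : ∃ Λ : ℝ, 0 ≤ Λ ∧ ∀ κ i j, |S.rate κ i j| ≤ Λ := by
  obtain ⟨Λ, hΛ⟩ := Finite.bddAbove_range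
    fun p : Fin K × Fin N × Fin N => |S.rate p.1 p.2.1 p.2.2|
  exact ⟨max Λ 0, le_max_right _ _, fun κ i j =>
    (hΛ (mem_range_self (κ, i, j))).trans (le_max_left _ _)⟩

theorem sum_rate (κ : Fin K) (i : Fin N) : ∑ j, S.rate κ i j = 0 := by
  rw [← Finset.add_sum_erase _ _ (Finset.mem_univ i), S.rate_diag]
  ring

/-- The rate of the switches from `i` to `j`, accumulated along the path `x` during
`[t, t + h]`. -/
noncomputable def cumRate (x : ℝ → EuclideanSpace ℝ (Fin n)) (i j : Fin N) (t h : ℝ) : ℝ :=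
  ∫ s in t..(t + h), S.rate (S.region (x s)) i j

theorem abs_cumRate_le {Λ : ℝ} (hΛ : ∀ κ i j, |S.rate κ i j| ≤ Λ)
    (x : ℝ → EuclideanSpace ℝ (Fin n)) (i j : Fin N) (t : ℝ) {h : ℝ} (hh : 0 ≤ h) :
    |S.cumRate x i j t h| ≤ Λ * h := by
  have := intervalIntegral.norm_integral_le_of_norm_le_const (a := t) (b := t + h) (C := Λ)
    (f := fun s => S.rate (S.region (x s)) i j) (fun s _ => hΛ _ i j)
  simpa [cumRate, abs_of_nonneg hh] using this

variable {S}

theorem IsSolution.intervalIntegrable_rate {r : ℝ → Fin N} {x : ℝ → EuclideanSpace ℝ (Fin n)}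
    (hx : S.IsSolution r x) (i j : Fin N) {t h : ℝ} (ht : 0 ≤ t) (hh : 0 ≤ h) :
    IntervalIntegrable (fun s => S.rate (S.region (x s)) i j) volume t (t + h) := by
  obtain ⟨Λ, -, hΛ⟩ := S.exists_forall_abs_rate_le
  rw [intervalIntegrable_iff_integrableOn_Ioc_of_le (by linarith)]
  have hxm : AEMeasurable x (volume.restrict (Ioc t (t + h))) :=
    (hx.1.mono fun s hs => ht.trans hs.1.le).aemeasurable measurableSet_Ioc
  exact Integrable.of_bound
    ((S.measurable_rate_region i j).comp_aemeasurable hxm).aestronglyMeasurable Λ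
    (ae_of_all _ fun s => hΛ _ i j)

theorem IsSolution.sum_cumRate {r : ℝ → Fin N} {x : ℝ → EuclideanSpace ℝ (Fin n)}
    (hx : S.IsSolution r x) (i : Fin N) {t h : ℝ} (ht : 0 ≤ t) (hh : 0 ≤ h) :
    ∑ j, S.cumRate x i j t h = 0 := by
  simp only [cumRate]
  rw [← intervalIntegral.integral_finsetSum
    fun j _ => hx.intervalIntegrable_rate i j ht hh]
  simp [S.sum_rate]

variable {Ω : Type*} [MeasurableSpace Ω] {P : Measure Ω} {x₀ : EuclideanSpace ℝ (Fin n)}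
  {i₀ : Fin N} {x : ℝ → Ω → EuclideanSpace ℝ (Fin n)} {θ : ℝ → Ω → Fin N}

theorem IsRealization.exists_measurable_uncurry (hR : S.IsRealization P x₀ i₀ x θ) :
    ∃ y : ℝ → Ω → EuclideanSpace ℝ (Fin n), Measurable (Function.uncurry y) ∧
      ∀ᵐ ω ∂P, ∀ t, 0 ≤ t → x t ω = y t ω :=
  exists_measurable_uncurry_of_continuousOn hR.measurable_x (hR.solution.mono fun _ h => h.1)

theorem IsRealization.aestronglyMeasurable_cumRate (hR : S.IsRealization P x₀ i₀ x θ)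
    (i j : Fin N) {t h : ℝ} (ht : 0 ≤ t) (hh : 0 ≤ h) :
    AEStronglyMeasurable (fun ω => S.cumRate (fun s => x s ω) i j t h) P := by
  obtain ⟨y, hy, hxy⟩ := hR.exists_measurable_uncurry
  refine ⟨fun ω => ∫ s in Ioc t (t + h), S.rate (S.region (y s ω)) i j, ?_, ?_⟩
  · exact StronglyMeasurable.integral_prod_left
      (f := fun s ω => S.rate (S.region (y s ω)) i j)
      ((S.measurable_rate_region i j).comp hy).stronglyMeasurable
  · filter_upwards [hxy] with ω hω
    rw [cumRate, intervalIntegral.integral_of_le (by linarith)]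
    exact setIntegral_congr_fun measurableSet_Ioc fun s hs => by
      simp only [hω s (ht.trans hs.1.le)]

end SDJLS

/-! ### The expected change of a function of the mode -/

/-- If two conditional expectations differ by at most `e` where the `m`-measurable weight `g` does
not vanish, then the weighted expectations differ by at most `B * e`, where `B` bounds `|g|`. -/
theorem abs_integral_mul_sub_integral_mul_le {Ω : Type*} {m m₀ : MeasurableSpace Ω}
    {P : Measure Ω} [IsProbabilityMeasure P] (hm : m ≤ m₀) {f₁ f₂ g : Ω → ℝ}
    (hf₁ : Integrable f₁ P) (hf₂ : Integrable f₂ P) (hg : StronglyMeasurable[m] g) {B e : ℝ}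
    (he : 0 ≤ e) (hB : ∀ᵐ ω ∂P, |g ω| ≤ B)
    (hfe : ∀ᵐ ω ∂P, g ω ≠ 0 → |(P[f₁ | m]) ω - (P[f₂ | m]) ω| ≤ e) :
    |∫ ω, g ω * f₁ ω ∂P - ∫ ω, g ω * f₂ ω ∂P| ≤ B * e := by
  have hg₀ : AEStronglyMeasurable g P := (hg.mono hm).aestronglyMeasurable
  have hi : ∀ f : Ω → ℝ, Integrable f P → Integrable (fun ω => g ω * f ω) P := fun f hf =>
    hf.bdd_mul hg₀ hB
  have key : ∀ f : Ω → ℝ, Integrable f P → ∫ ω, g ω * f ω ∂P = ∫ ω, g ω * (P[f | m]) ω ∂P := by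
    intro f hf
    rw [← integral_condExp hm (f := fun ω => g ω * f ω)]
    exact integral_congr_ae (condExp_mul_of_stronglyMeasurable_left hg (hi f hf) hf)
  rw [key f₁ hf₁, key f₂ hf₂, ← integral_sub (hi _ integrable_condExp) (hi _ integrable_condExp)]
  have hle : ∀ᵐ ω ∂P, ‖g ω * (P[f₁ | m]) ω - g ω * (P[f₂ | m]) ω‖ ≤ B * e := by
    filter_upwards [hB, hfe] with ω h1 h2
    rw [← mul_sub, Real.norm_eq_abs, abs_mul]
    by_cases h0 : g ω = 0
    · rw [h0, abs_zero, zero_mul]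
      exact mul_nonneg ((abs_nonneg _).trans h1) he
    · exact mul_le_mul h1 (h2 h0) (abs_nonneg _) ((abs_nonneg _).trans h1)
  simpa using norm_integral_le_of_norm_le_const hle

namespace SDJLS

variable {n N K : ℕ} {S : SDJLS n N K} {Ω : Type*} [MeasurableSpace Ω] {P : Measure Ω}
  {x₀ : EuclideanSpace ℝ (Fin n)} {i₀ : Fin N} {x : ℝ → Ω → EuclideanSpace ℝ (Fin n)}
  {θ : ℝ → Ω → Fin N}

/-- The change of `V` due to the mode alone, split over the pairs of modes before and after. -/
theorem sum_sum_ite_mul_eq (V : Fin N → ℝ) (k l : Fin N) (J : Fin N → Fin N → ℝ)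
    (hJ : ∑ j, J k j = 0) :
    ∑ i, ∑ j, ((if k = i then V j - V i else 0) * (if l = j then 1 else 0)
      - (if k = i then V j - V i else 0) * J i j) = V l - V k - ∑ j, V j * J k j := by
  have h1 : ∀ i, ∑ j, ((if k = i then V j - V i else 0) * (if l = j then 1 else 0)
      - (if k = i then V j - V i else 0) * J i j) =
      if k = i then V l - V i - ∑ j, (V j - V i) * J i j else 0 := by
    intro i
    split_ifs <;> simp
  rw [Finset.sum_congr rfl fun i _ => h1 i, Finset.sum_ite_eq]
  simp only [Finset.mem_univ, if_true, sub_mul, Finset.sum_sub_distrib, ← Finset.mul_sum, hJ]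
  ring

theorem IsRealization.integrable_cumRate [IsProbabilityMeasure P]
    (hR : S.IsRealization P x₀ i₀ x θ) (i j : Fin N) {t h : ℝ} (ht : 0 ≤ t) (hh : 0 ≤ h) :
    Integrable (fun ω => S.cumRate (fun s => x s ω) i j t h) P := by
  obtain ⟨Λ, -, hΛ⟩ := S.exists_forall_abs_rate_le
  exact Integrable.of_bound (hR.aestronglyMeasurable_cumRate i j ht hh) (Λ * h)
    (ae_of_all _ fun ω => S.abs_cumRate_le hΛ _ i j t hh)

/-- With the state frozen at time `t`, the expected change of `V` caused by the mode during
`[t, t + h]` is `E ∑ⱼ Vⱼ(x(t)) ∫ λ_{θ(t) j}` up to an error `o(h)` uniform for `t ≤ T`. -/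
theorem IsRealization.exists_isLittleO_mode_change [IsProbabilityMeasure P]
    (hR : S.IsRealization P x₀ i₀ x θ) {V : Fin N → EuclideanSpace ℝ (Fin n) → ℝ}
    (hV : ∀ i, Measurable (V i)) {B T : ℝ}
    (hB : ∀ t ∈ Icc 0 T, ∀ᵐ ω ∂P, ∀ i, |V i (x t ω)| ≤ B) :
    ∃ o : ℝ → ℝ, o =o[𝓝[>] 0] (fun h : ℝ => h) ∧ ∀ t ∈ Icc 0 T, ∀ h, 0 < h →
      |∫ ω, (V (θ (t + h) ω) (x t ω) - V (θ t ω) (x t ω)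
        - ∑ j, V j (x t ω) * S.cumRate (fun s => x s ω) (θ t ω) j t h) ∂P| ≤ o h := by
  classical
  have hrates : ∀ i j, ∃ o : ℝ → ℝ, o =o[𝓝[>] 0] (fun h : ℝ => h) ∧
      ∀ t ∈ Icc 0 T, ∀ h, 0 < h → i ≠ j → ∀ᵐ ω ∂P, θ t ω = i →
        |(P⟦{ω' | θ (t + h) ω' = j} | sigmaAt x θ t⟧) ω
          - (P[fun ω' => S.cumRate (fun s => x s ω') i j t h | sigmaAt x θ t]) ω| ≤ o h := by
    intro i j
    by_cases hij : i = j
    · -- The weight `V_j - V_i` of a diagonal pair vanishes below, so no estimate is needed here.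
      exact ⟨0, Asymptotics.isLittleO_zero _ _, fun _ _ _ _ h => absurd hij h⟩
    · obtain ⟨o, ho, h⟩ := hR.rates i j hij T
      exact ⟨o, ho, fun t ht h' hh _ => h t ht h' hh⟩
  choose o ho hrate using hrates
  refine ⟨fun h => ∑ i, ∑ j, 2 * B * |o i j h|, ?_, fun t ht h hh => ?_⟩
  · exact Asymptotics.IsLittleO.fun_sum fun i _ => Asymptotics.IsLittleO.fun_sum fun j _ =>
      (ho i j).norm_left.const_mul_left _
  have hmx := hR.measurable_x t ht.1
  have hmθ := hR.measurable_θ t ht.1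
  have hmθ' := hR.measurable_θ (t + h) (by linarith [ht.1])
  have hm : sigmaAt x θ t ≤ ‹MeasurableSpace Ω› := (hmx.prodMk hmθ).comap_le
  set g : Fin N → Fin N → Ω → ℝ := fun i j ω =>
    if θ t ω = i then V j (x t ω) - V i (x t ω) else 0 with hg
  set f : Fin N → Ω → ℝ := fun j ω => if θ (t + h) ω = j then 1 else 0 with hf
  set J : Fin N → Fin N → Ω → ℝ := fun i j ω => S.cumRate (fun s => x s ω) i j t h with hJ
  have hgm : ∀ i j, StronglyMeasurable[sigmaAt x θ t] (g i j) := by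
    intro i j
    have hφ : Measurable fun p : EuclideanSpace ℝ (Fin n) × Fin N =>
        if p.2 = i then V j p.1 - V i p.1 else 0 :=
      Measurable.ite (measurable_snd (measurableSet_singleton i))
        (((hV j).comp measurable_fst).sub ((hV i).comp measurable_fst)) measurable_const
    exact (hφ.comp (comap_measurable fun ω => (x t ω, θ t ω))).stronglyMeasurable
  have hgB : ∀ i j, ∀ᵐ ω ∂P, |g i j ω| ≤ 2 * B := by
    intro i j
    filter_upwards [hB t ht] with ω hω
    have h0 : 0 ≤ B := (abs_nonneg _).trans (hω i)
    simp only [hg]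
    split_ifs
    · have := abs_sub (V j (x t ω)) (V i (x t ω))
      linarith [hω i, hω j]
    · simpa using h0
  have hfset : ∀ j, f j = {ω | θ (t + h) ω = j}.indicator fun _ => (1 : ℝ) := by
    intro j
    ext ω
    simp [hf, indicator_apply]
  have hfi : ∀ j, Integrable (f j) P := by
    intro j
    rw [hfset]
    exact (integrable_const _).indicator (hmθ' (measurableSet_singleton j))
  have hJi : ∀ i j, Integrable (J i j) P := fun i j => hR.integrable_cumRate i j ht.1 hh.le
  have hmul : ∀ i j, ∀ u : Ω → ℝ, Integrable u P → Integrable (fun ω => g i j ω * u ω) P :=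
    fun i j u hu => hu.bdd_mul ((hgm i j).mono hm).aestronglyMeasurable (hgB i j)
  have hpair : ∀ i j, |∫ ω, g i j ω * f j ω ∂P - ∫ ω, g i j ω * J i j ω ∂P|
      ≤ 2 * B * |o i j h| := by
    intro i j
    refine abs_integral_mul_sub_integral_mul_le hm (hfi j) (hJi i j) (hgm i j) (abs_nonneg _)
      (hgB i j) ?_
    by_cases hij : i = j
    · refine ae_of_all _ fun ω h0 => absurd ?_ h0
      simp [hg, hij]
    · filter_upwards [hrate i j t ht h hh hij] with ω hω h0
      have hi : θ t ω = i := by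
        by_contra hne
        exact h0 (if_neg hne)
      rw [hfset]
      exact (hω hi).trans (le_abs_self _)
  have heq : ∀ᵐ ω ∂P, V (θ (t + h) ω) (x t ω) - V (θ t ω) (x t ω)
      - ∑ j, V j (x t ω) * S.cumRate (fun s => x s ω) (θ t ω) j t h
      = ∑ i, ∑ j, (g i j ω * f j ω - g i j ω * J i j ω) := by
    filter_upwards [hR.solution] with ω hω
    exact (sum_sum_ite_mul_eq (fun i => V i (x t ω)) _ _ (fun i j => J i j ω)
      (hω.sum_cumRate _ ht.1 hh.le)).symm
  have hint : ∀ i j, Integrable (fun ω => g i j ω * f j ω - g i j ω * J i j ω) P :=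
    fun i j => (hmul i j _ (hfi j)).sub (hmul i j _ (hJi i j))
  rw [integral_congr_ae heq,
    integral_finsetSum _ fun i _ => integrable_finsetSum _ fun j _ => hint i j]
  refine (Finset.abs_sum_le_sum_abs _ _).trans (Finset.sum_le_sum fun i _ => ?_)
  rw [integral_finsetSum _ fun j _ => hint i j]
  refine (Finset.abs_sum_le_sum_abs _ _).trans (Finset.sum_le_sum fun j _ => ?_)
  rw [integral_sub (hmul i j _ (hfi j)) (hmul i j _ (hJi i j))]
  exact hpair i j

end SDJLS

/-! ### Decay of the mean energy -/

theorem integrable_comp_of_measurable {Ω ι : Type*} [MeasurableSpace Ω] {P : Measure Ω} [Fintype ι]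
    [MeasurableSpace ι] [MeasurableSingletonClass ι] {F : ι → Ω → ℝ} {k : Ω → ι}
    (hk : Measurable k) (hF : ∀ i, Integrable (F i) P) : Integrable (fun ω => F (k ω) ω) P := by
  classical
  have h : (fun ω => F (k ω) ω) = fun ω => ∑ i, (k ⁻¹' {i}).indicator (F i) ω := by
    ext ω
    simp [indicator_apply]
  rw [h]
  exact integrable_finsetSum _ fun i _ => (hF i).indicator (hk (measurableSet_singleton i))

/-- A function on `[a, b]` with a right modulus of continuity that is uniform in the base point is
continuous, also from the left. -/
theorem continuousOn_Icc_of_abs_sub_le {f w : ℝ → ℝ} {a b : ℝ}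
    (hw : Tendsto w (𝓝[>] 0) (𝓝 0))
    (hf : ∀ t h, a ≤ t → 0 < h → t + h ≤ b → |f (t + h) - f t| ≤ w h) :
    ContinuousOn f (Icc a b) := by
  rw [Metric.continuousOn_iff]
  intro t ht ε hε
  have hev : ∀ᶠ h in 𝓝[>] (0 : ℝ), w h < ε := hw.eventually (gt_mem_nhds hε)
  obtain ⟨δ, hδ, hsub⟩ := mem_nhdsGT_iff_exists_Ioo_subset.1 hev
  have hlt : ∀ u ∈ Icc a b, ∀ v ∈ Icc a b, u < v → v - u < δ → |f v - f u| < ε := by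
    intro u hu v hv huv hd
    have := hf u (v - u) hu.1 (by linarith) (by linarith [hv.2])
    rw [add_sub_cancel] at this
    exact this.trans_lt (hsub ⟨by linarith, hd⟩)
  refine ⟨δ, hδ, fun s hs hd => ?_⟩
  rw [Real.dist_eq] at hd ⊢
  rcases lt_trichotomy s t with h | h | h
  · rw [abs_sub_comm]
    exact hlt s hs t ht h (by rw [abs_sub_comm] at hd; exact (le_abs_self _).trans_lt hd)
  · simpa [h] using hε
  · exact hlt t ht s hs h ((le_abs_self _).trans_lt hd)

namespace SDJLS

variable {n N K : ℕ} {S : SDJLS n N K}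

theorem IsSolution.sum_mul_cumRate_le {r : ℝ → Fin N} {x : ℝ → EuclideanSpace ℝ (Fin n)}
    (hx : S.IsSolution r x) {i : Fin N} {v : Fin N → ℝ} {b : ℝ}
    (hb : ∀ κ, ∑ j, S.rate κ i j * v j ≤ b) {t h : ℝ} (ht : 0 ≤ t) (hh : 0 ≤ h) :
    ∑ j, v j * S.cumRate x i j t h ≤ b * h := by
  have hi := fun j => hx.intervalIntegrable_rate i j ht hh
  have h1 : ∑ j, v j * S.cumRate x i j t h =
      ∫ s in t..(t + h), ∑ j, S.rate (S.region (x s)) i j * v j := by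
    rw [intervalIntegral.integral_finsetSum fun j _ => (hi j).mul_const (v j)]
    simp [cumRate, mul_comm]
  have h2 : b * h = ∫ _ in t..(t + h), b := by
    simp [mul_comm]
  have hsum : IntervalIntegrable (fun s => ∑ j, S.rate (S.region (x s)) i j * v j) volume
      t (t + h) := by
    have := IntervalIntegrable.sum (Finset.univ : Finset (Fin N))
      fun j _ => (hi j).mul_const (v j)
    simpa only [Finset.sum_fn] using this
  rw [h1, h2]
  exact intervalIntegral.integral_mono_on (by linarith) hsum intervalIntegrable_const
    fun s _ => hb _

variable {Ω : Type*} [MeasurableSpace Ω] {P : Measure Ω} {x₀ : EuclideanSpace ℝ (Fin n)}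
  {i₀ : Fin N} {x : ℝ → Ω → EuclideanSpace ℝ (Fin n)} {θ : ℝ → Ω → Fin N}

theorem IsRealization.exists_abs_quadForm_le (hR : S.IsRealization P x₀ i₀ x θ)
    (M : Fin N → Matrix (Fin n) (Fin n) ℝ) (T : ℝ) :
    ∃ B : ℝ, 0 ≤ B ∧ ∀ᵐ ω ∂P, ∀ t ∈ Icc 0 T, ∀ i, |quadForm (M i) (x t ω)| ≤ B := by
  obtain ⟨CA, hCA0, hCA⟩ := exists_forall_norm_toEuclideanLin_le S.A
  obtain ⟨CM, hCM0, hCM⟩ := exists_forall_norm_toEuclideanLin_le M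
  refine ⟨CM * (‖x₀‖ * Real.exp (CA * T)) ^ 2, by positivity, ?_⟩
  filter_upwards [hR.solution, hR.init_x] with ω hω h0 t ht i
  refine (abs_quadForm_le (hCM i) _).trans ?_
  gcongr
  rw [← h0]
  exact hω.norm_le_of_le hCA0 hCA ht.1 ht.2

theorem IsRealization.exists_abs_quadForm_sub_le (hR : S.IsRealization P x₀ i₀ x θ)
    (M : Fin N → Matrix (Fin n) (Fin n) ℝ) (T : ℝ) :
    ∃ L : ℝ, 0 ≤ L ∧ ∀ᵐ ω ∂P, ∀ s t, 0 ≤ s → s ≤ t → t ≤ T → ∀ i,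
      |quadForm (M i) (x t ω) - quadForm (M i) (x s ω)| ≤ L * (t - s) := by
  obtain ⟨CA, hCA0, hCA⟩ := exists_forall_norm_toEuclideanLin_le S.A
  obtain ⟨CM, hCM0, hCM⟩ := exists_forall_norm_toEuclideanLin_le M
  set R := ‖x₀‖ * Real.exp (CA * T) with hRdef
  have hR0 : 0 ≤ R := by positivity
  refine ⟨CM * (R + R) * (CA * R), by positivity, ?_⟩
  filter_upwards [hR.solution, hR.init_x] with ω hω h0 s t hs hst ht i
  have hb : ∀ u, 0 ≤ u → u ≤ T → ‖x u ω‖ ≤ R := fun u hu huT => by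
    rw [hRdef, ← h0]
    exact hω.norm_le_of_le hCA0 hCA hu huT
  have hd : ‖x t ω - x s ω‖ ≤ CA * R * (t - s) := by
    rw [hRdef, ← h0]
    exact hω.norm_sub_le hCA0 hCA hs hst ht
  refine (abs_quadForm_sub_le (hCM i) _ _).trans ?_
  rw [mul_assoc (CM * (R + R))]
  gcongr
  · exact hb t (hs.trans hst) ht
  · exact hb s hs (hst.trans ht)

theorem IsRealization.integrable_quadForm [IsProbabilityMeasure P]
    (hR : S.IsRealization P x₀ i₀ x θ) (M : Matrix (Fin n) (Fin n) ℝ) {t : ℝ} (ht : 0 ≤ t) :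
    Integrable (fun ω => quadForm M (x t ω)) P := by
  obtain ⟨B, -, hB⟩ := hR.exists_abs_quadForm_le (fun _ => M) t
  refine Integrable.of_bound ((continuous_quadForm M).measurable.comp
    (hR.measurable_x t ht)).aestronglyMeasurable B ?_
  filter_upwards [hB] with ω hω
  exact hω t ⟨ht, le_rfl⟩ i₀

theorem IsRealization.integrable_quadForm_mode [IsProbabilityMeasure P]
    (hR : S.IsRealization P x₀ i₀ x θ) (M : Fin N → Matrix (Fin n) (Fin n) ℝ) {s t : ℝ}
    (hs : 0 ≤ s) (ht : 0 ≤ t) : Integrable (fun ω => quadForm (M (θ s ω)) (x t ω)) P :=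
  integrable_comp_of_measurable (F := fun i ω => quadForm (M i) (x t ω)) (hR.measurable_θ s hs)
    fun i => hR.integrable_quadForm (M i) ht

theorem IsRealization.integrable_sum_quadForm_mul_cumRate [IsProbabilityMeasure P]
    (hR : S.IsRealization P x₀ i₀ x θ) (M : Fin N → Matrix (Fin n) (Fin n) ℝ) {t h : ℝ}
    (ht : 0 ≤ t) (hh : 0 ≤ h) :
    Integrable (fun ω => ∑ j, quadForm (M j) (x t ω) *
      S.cumRate (fun s => x s ω) (θ t ω) j t h) P := by
  obtain ⟨Λ, -, hΛ⟩ := S.exists_forall_abs_rate_le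
  refine integrable_comp_of_measurable (F := fun i ω => ∑ j, quadForm (M j) (x t ω) *
      S.cumRate (fun s => x s ω) i j t h) (hR.measurable_θ t ht)
    fun i => integrable_finsetSum _ fun j _ => ?_
  exact (hR.integrable_quadForm (M j) ht).mul_bdd (c := Λ * h)
    (hR.aestronglyMeasurable_cumRate i j ht hh)
    (ae_of_all _ fun ω => S.abs_cumRate_le hΛ _ i j t hh)

/-- The expectation `E V_{θ(t)}(x(t))` of the mode-dependent Lyapunov function
`V_i(x) = xᵀ P_i x`. -/
noncomputable def meanEnergy (P : Measure Ω) (M : Fin N → Matrix (Fin n) (Fin n) ℝ)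
    (x : ℝ → Ω → EuclideanSpace ℝ (Fin n)) (θ : ℝ → Ω → Fin N) (t : ℝ) : ℝ :=
  ∫ ω, quadForm (M (θ t ω)) (x t ω) ∂P

/-- The increment of the mean energy: the motion of the state with the final mode, the error of
the transition rates, and the accumulated rates. -/
theorem IsRealization.meanEnergy_sub [IsProbabilityMeasure P]
    (hR : S.IsRealization P x₀ i₀ x θ) (M : Fin N → Matrix (Fin n) (Fin n) ℝ) {t h : ℝ}
    (ht : 0 ≤ t) (hh : 0 ≤ h) :
    meanEnergy P M x θ (t + h) - meanEnergy P M x θ t =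
      ∫ ω, (quadForm (M (θ (t + h) ω)) (x (t + h) ω) - quadForm (M (θ (t + h) ω)) (x t ω)) ∂P
      + ∫ ω, (quadForm (M (θ (t + h) ω)) (x t ω) - quadForm (M (θ t ω)) (x t ω)
        - ∑ j, quadForm (M j) (x t ω) * S.cumRate (fun s => x s ω) (θ t ω) j t h) ∂P
      + ∫ ω, ∑ j, quadForm (M j) (x t ω) * S.cumRate (fun s => x s ω) (θ t ω) j t h ∂P := by
  have hth : 0 ≤ t + h := add_nonneg ht hh
  have i1 := hR.integrable_quadForm_mode M hth hth
  have i2 := hR.integrable_quadForm_mode M hth ht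
  have i3 := hR.integrable_quadForm_mode M ht ht
  have i4 := hR.integrable_sum_quadForm_mul_cumRate M ht hh
  rw [integral_sub i1 i2, integral_sub (f := fun ω =>
    quadForm (M (θ (t + h) ω)) (x t ω) - quadForm (M (θ t ω)) (x t ω)) (i2.sub i3) i4,
    integral_sub i2 i3]
  simp only [meanEnergy]
  ring

theorem IsRealization.exists_isLittleO_quadForm_mode_change [IsProbabilityMeasure P]
    (hR : S.IsRealization P x₀ i₀ x θ) (M : Fin N → Matrix (Fin n) (Fin n) ℝ) (T : ℝ) :
    ∃ o : ℝ → ℝ, o =o[𝓝[>] 0] (fun h : ℝ => h) ∧ ∀ t ∈ Icc 0 T, ∀ h, 0 < h →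
      |∫ ω, (quadForm (M (θ (t + h) ω)) (x t ω) - quadForm (M (θ t ω)) (x t ω)
        - ∑ j, quadForm (M j) (x t ω) * S.cumRate (fun s => x s ω) (θ t ω) j t h) ∂P| ≤ o h := by
  obtain ⟨B, -, hB⟩ := hR.exists_abs_quadForm_le M T
  exact hR.exists_isLittleO_mode_change (V := fun i => quadForm (M i))
    (fun i => (continuous_quadForm (M i)).measurable)
    (fun t ht => hB.mono fun ω hω => hω t ht)

theorem IsRealization.continuousOn_meanEnergy [IsProbabilityMeasure P]
    (hR : S.IsRealization P x₀ i₀ x θ) (M : Fin N → Matrix (Fin n) (Fin n) ℝ) (T : ℝ) :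
    ContinuousOn (meanEnergy P M x θ) (Icc 0 T) := by
  obtain ⟨Λ, hΛ0, hΛ⟩ := S.exists_forall_abs_rate_le
  obtain ⟨B, hB0, hB⟩ := hR.exists_abs_quadForm_le M T
  obtain ⟨L, hL0, hL⟩ := hR.exists_abs_quadForm_sub_le M T
  obtain ⟨o, ho, hmode⟩ := hR.exists_isLittleO_quadForm_mode_change M T
  have hid : Tendsto (fun h : ℝ => h) (𝓝[>] 0) (𝓝 0) := tendsto_id.mono_left nhdsWithin_le_nhds
  refine continuousOn_Icc_of_abs_sub_le (w := fun h => L * h + o h + N * (B * (Λ * h))) ?_ ?_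
  · have h1 : Tendsto o (𝓝[>] 0) (𝓝 0) := ho.trans_tendsto hid
    have := ((hid.const_mul L).add h1).add (((hid.const_mul Λ).const_mul B).const_mul (N : ℝ))
    simpa using this
  · intro t h ht hh hT
    have htT : t ∈ Icc 0 T := ⟨ht, by linarith⟩
    rw [hR.meanEnergy_sub M ht hh.le]
    refine (abs_add_le _ _).trans (add_le_add ((abs_add_le _ _).trans (add_le_add ?_ ?_)) ?_)
    · have : ∀ᵐ ω ∂P, ‖quadForm (M (θ (t + h) ω)) (x (t + h) ω)
          - quadForm (M (θ (t + h) ω)) (x t ω)‖ ≤ L * h := by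
        filter_upwards [hL] with ω hω
        simpa using hω t (t + h) ht (by linarith) hT (θ (t + h) ω)
      simpa using norm_integral_le_of_norm_le_const this
    · exact hmode t htT h hh
    · have : ∀ᵐ ω ∂P, ‖∑ j, quadForm (M j) (x t ω) *
          S.cumRate (fun s => x s ω) (θ t ω) j t h‖ ≤ N * (B * (Λ * h)) := by
        filter_upwards [hB] with ω hω
        have hj : ∀ j ∈ (Finset.univ : Finset (Fin N)), ‖quadForm (M j) (x t ω) *
            S.cumRate (fun s => x s ω) (θ t ω) j t h‖ ≤ B * (Λ * h) := fun j _ => by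
          rw [norm_mul]
          exact mul_le_mul (hω t htT j) (S.abs_cumRate_le hΛ _ _ j t hh.le) (norm_nonneg _) hB0
        simpa using norm_sum_le_of_le _ hj
      simpa using norm_integral_le_of_norm_le_const this

/-- The motion of the state contributes `E xᵀ(A_iᵀP_i + P_iA_i)x`, with `i = θ(t)`, to the right
derivative of the mean energy. By right-continuity of the path of `θ` the mode is constant just
after `t`, and the Lipschitz bound dominates the difference quotients. -/
theorem IsRealization.tendsto_integral_slope [IsProbabilityMeasure P]
    (hR : S.IsRealization P x₀ i₀ x θ) (M : Fin N → Matrix (Fin n) (Fin n) ℝ) {t : ℝ}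
    (ht : 0 ≤ t) :
    Tendsto (fun z => ∫ ω, (z - t)⁻¹ *
        (quadForm (M (θ z ω)) (x z ω) - quadForm (M (θ z ω)) (x t ω)) ∂P) (𝓝[>] t)
      (𝓝 (∫ ω, quadForm ((S.A (θ t ω)).transpose * M (θ t ω) + M (θ t ω) * S.A (θ t ω))
        (x t ω) ∂P)) := by
  obtain ⟨L, hL0, hL⟩ := hR.exists_abs_quadForm_sub_le M (t + 1)
  have hIoo : ∀ᶠ z in 𝓝[>] t, z ∈ Ioo t (t + 1) := Ioo_mem_nhdsGT (by linarith)
  refine tendsto_integral_filter_of_dominated_convergence (fun _ => L) ?_ ?_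
    (integrable_const L) ?_
  · filter_upwards [hIoo] with z hz
    have hz0 : 0 ≤ z := ht.trans hz.1.le
    exact (((hR.integrable_quadForm_mode M hz0 hz0).sub
      (hR.integrable_quadForm_mode M hz0 ht)).const_mul _).aestronglyMeasurable
  · filter_upwards [hIoo] with z hz
    filter_upwards [hL] with ω hω
    have hpos : 0 < z - t := sub_pos.2 hz.1
    rw [norm_mul, Real.norm_eq_abs, Real.norm_eq_abs, abs_of_pos (inv_pos.2 hpos),
      inv_mul_le_iff₀ hpos, mul_comm]
    exact hω t z ht hz.1.le hz.2.le _
  · filter_upwards [hR.solution, hR.jumpPath] with ω hω hjump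
    have hd := (hω.2 t ht).quadForm (P := M (θ t ω))
    have hs := (hasDerivWithinAt_iff_tendsto_slope' (by simp)).1 (hd.mono Ioi_subset_Ici_self)
    refine hs.congr' ?_
    filter_upwards [hjump.1 t ht] with z hz
    rw [slope_def_field, hz, div_eq_inv_mul]

theorem IsRealization.eventually_slope_meanEnergy_lt [IsProbabilityMeasure P]
    (hR : S.IsRealization P x₀ i₀ x θ) {M : Fin N → Matrix (Fin n) (Fin n) ℝ} {c : ℝ}
    (hM : ∀ κ i y, quadForm ((S.A i).transpose * M i + M i * S.A i) y
      + ∑ j, S.rate κ i j * quadForm (M j) y ≤ -c * quadForm (M i) y)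
    {t r : ℝ} (ht : 0 ≤ t) (hr : -c * meanEnergy P M x θ t < r) :
    ∀ᶠ z in 𝓝[>] t, (z - t)⁻¹ * (meanEnergy P M x θ z - meanEnergy P M x θ t) < r := by
  obtain ⟨o, ho, hmode⟩ := hR.exists_isLittleO_quadForm_mode_change M t
  set D := ∫ ω, quadForm ((S.A (θ t ω)).transpose * M (θ t ω) + M (θ t ω) * S.A (θ t ω))
    (x t ω) ∂P with hD
  have hshift : Tendsto (fun z => z - t) (𝓝[>] t) (𝓝[>] 0) := by
    refine tendsto_nhdsWithin_iff.2 ⟨?_, ?_⟩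
    · have : Tendsto (fun z => z - t) (𝓝 t) (𝓝 (t - t)) := tendsto_id.sub_const t
      rw [sub_self] at this
      exact this.mono_left nhdsWithin_le_nhds
    · filter_upwards [self_mem_nhdsWithin] with z hz
      exact sub_pos.2 (mem_Ioi.1 hz)
  have hlim := ((hR.tendsto_integral_slope M ht).add
    (ho.tendsto_div_nhds_zero.comp hshift)).add_const (-c * meanEnergy P M x θ t - D)
  rw [add_zero, add_sub_cancel] at hlim
  filter_upwards [hlim.eventually (gt_mem_nhds hr), self_mem_nhdsWithin] with z hz htz
  refine lt_of_le_of_lt ?_ hz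
  obtain ⟨h, hh, rfl⟩ : ∃ h, 0 < h ∧ z = t + h := ⟨z - t, sub_pos.2 htz, by ring⟩
  have i3 := hR.integrable_quadForm_mode M ht ht
  have iD := integrable_comp_of_measurable (F := fun i ω =>
      quadForm ((S.A i).transpose * M i + M i * S.A i) (x t ω)) (hR.measurable_θ t ht)
    fun i => hR.integrable_quadForm _ ht
  have hrate : ∫ ω, ∑ j, quadForm (M j) (x t ω) * S.cumRate (fun s => x s ω) (θ t ω) j t h ∂P
      ≤ (-c * meanEnergy P M x θ t - D) * h := by
    have heq : (-c * meanEnergy P M x θ t - D) * h = ∫ ω, (-c * quadForm (M (θ t ω)) (x t ω)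
        - quadForm ((S.A (θ t ω)).transpose * M (θ t ω) + M (θ t ω) * S.A (θ t ω))
          (x t ω)) * h ∂P := by
      rw [integral_mul_const, integral_sub (i3.const_mul _) iD, integral_const_mul, meanEnergy]
    rw [heq]
    refine integral_mono_ae (hR.integrable_sum_quadForm_mul_cumRate M ht hh.le)
      (((i3.const_mul _).sub iD).mul_const h) ?_
    filter_upwards [hR.solution] with ω hω
    exact hω.sum_mul_cumRate_le (fun κ => by linarith [hM κ (θ t ω) (x t ω)]) ht hh.le
  have hmode' := (le_abs_self _).trans (hmode t ⟨ht, le_rfl⟩ h hh)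
  rw [hR.meanEnergy_sub M ht hh.le, integral_const_mul]
  simp only [Function.comp_apply, add_sub_cancel_left]
  rw [div_eq_inv_mul, ← sub_nonneg]
  have hfac : ∀ a b b' e e' : ℝ, h⁻¹ * a + h⁻¹ * b' + e' - h⁻¹ * (a + b + e)
      = h⁻¹ * ((b' - b) + (e' * h - e)) := fun a b b' e e' => by
    field_simp
    ring
  rw [hfac]
  exact mul_nonneg (inv_nonneg.2 hh.le) (add_nonneg (sub_nonneg.2 hmode') (sub_nonneg.2 hrate))

theorem IsRealization.meanEnergy_le_exp [IsProbabilityMeasure P]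
    (hR : S.IsRealization P x₀ i₀ x θ) {M : Fin N → Matrix (Fin n) (Fin n) ℝ} {c : ℝ}
    (hM : ∀ κ i y, quadForm ((S.A i).transpose * M i + M i * S.A i) y
      + ∑ j, S.rate κ i j * quadForm (M j) y ≤ -c * quadForm (M i) y)
    {t : ℝ} (ht : 0 ≤ t) :
    meanEnergy P M x θ t ≤ meanEnergy P M x θ 0 * Real.exp (-c * t) := by
  have h := le_gronwallBound_of_liminf_deriv_right_le (f := meanEnergy P M x θ)
    (f' := fun s => -c * meanEnergy P M x θ s) (a := 0) (b := t) (K := -c) (ε := 0)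
    (hR.continuousOn_meanEnergy M t)
    (fun s hs r hr => (hR.eventually_slope_meanEnergy_lt hM hs.1 hr).frequently) le_rfl
    (fun s _ => by simp) t ⟨ht, le_rfl⟩
  simpa [gronwallBound_ε0] using h

end SDJLS

/-! ### Stochastic stability -/

theorem theorem1 {n N K : ℕ} (S : SDJLS n N K)
    {Ω : Type*} [MeasurableSpace Ω] (Pr : Measure Ω) [IsProbabilityMeasure Pr]
    (h : ∃ (P : Fin N → Matrix (Fin n) (Fin n) ℝ) (W : Fin K → Fin N → Matrix (Fin n) (Fin n) ℝ),
      (∀ i, (P i).PosDef) ∧ (∀ κ i, (W κ i).PosDef) ∧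
        ∀ κ i, (S.A i).transpose * P i + P i * S.A i + ∑ j, S.rate κ i j • P j = -W κ i) :
    S.IsStochasticallyStable Pr := by
  obtain ⟨P, W, hP, hW, hPW⟩ := h
  intro x₀ i₀ x θ hR
  obtain ⟨p, hp, hpP⟩ := exists_pos_forall_mul_norm_sq_le_quadForm hP
  obtain ⟨w, hw, hwW⟩ := exists_pos_forall_mul_norm_sq_le_quadForm
    (M := fun k : Fin K × Fin N => W k.1 k.2) fun k => hW k.1 k.2
  obtain ⟨q, hq0, hq⟩ := exists_forall_norm_toEuclideanLin_le P
  -- `W_{κi} ≥ w ≥ (w / (q + 1)) P_i` as quadratic forms; `q` itself may vanish.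
  set c := w / (q + 1) with hc
  have hc0 : 0 < c := by positivity
  have hM : ∀ κ i y, quadForm ((S.A i).transpose * P i + P i * S.A i) y
      + ∑ j, S.rate κ i j * quadForm (P j) y ≤ -c * quadForm (P i) y := by
    intro κ i y
    rw [← quadForm_sum_smul, ← quadForm_add, hPW, quadForm_neg, neg_mul, neg_le_neg_iff]
    refine le_trans ?_ (hwW (κ, i) y)
    have h1 : quadForm (P i) y ≤ (q + 1) * ‖y‖ ^ 2 :=
      (le_abs_self _).trans ((abs_quadForm_le (hq i) y).trans (by gcongr; linarith))
    calc c * quadForm (P i) y ≤ c * ((q + 1) * ‖y‖ ^ 2) := by gcongr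
      _ = w * ‖y‖ ^ 2 := by rw [hc]; field_simp
  obtain ⟨y, hy, hxy⟩ := hR.exists_measurable_uncurry
  set a := p⁻¹ * SDJLS.meanEnergy Pr P x θ 0 with ha
  have hbound : ∀ t ∈ Ici (0 : ℝ), ∫⁻ ω, ENNReal.ofReal (‖y t ω‖ ^ 2) ∂Pr
      ≤ ENNReal.ofReal (a * Real.exp (-c * t)) := by
    intro t ht
    have hV := hR.integrable_quadForm_mode P ht ht
    calc ∫⁻ ω, ENNReal.ofReal (‖y t ω‖ ^ 2) ∂Pr
        ≤ ∫⁻ ω, ENNReal.ofReal (p⁻¹ * quadForm (P (θ t ω)) (x t ω)) ∂Pr := by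
          refine lintegral_mono_ae ?_
          filter_upwards [hxy] with ω hω
          rw [← hω t ht]
          refine ENNReal.ofReal_le_ofReal ?_
          rw [← div_eq_inv_mul, le_div_iff₀ hp, mul_comm]
          exact hpP _ _
      _ = ENNReal.ofReal (p⁻¹ * SDJLS.meanEnergy Pr P x θ t) := by
          rw [SDJLS.meanEnergy, ← integral_const_mul,
            ofReal_integral_eq_lintegral_ofReal (hV.const_mul _)]
          refine ae_of_all _ fun ω => mul_nonneg (inv_nonneg.2 hp.le) ?_
          exact (mul_nonneg hp.le (sq_nonneg _)).trans (hpP (θ t ω) (x t ω))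
      _ ≤ ENNReal.ofReal (a * Real.exp (-c * t)) := by
          rw [ha, mul_assoc]
          gcongr
          exact hR.meanEnergy_le_exp hM ht
  have hexp : IntegrableOn (fun t => a * Real.exp (-c * t)) (Ici 0) volume :=
    ((integrableOn_Ici_iff_integrableOn_Ioi).2 (exp_neg_integrableOn_Ioi 0 hc0)).const_mul a
  have hcongr : ∫⁻ ω, ∫⁻ t in Ici (0 : ℝ), ENNReal.ofReal (‖x t ω‖ ^ 2) ∂volume ∂Pr
      = ∫⁻ ω, ∫⁻ t in Ici (0 : ℝ), ENNReal.ofReal (‖y t ω‖ ^ 2) ∂volume ∂Pr := by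
    refine lintegral_congr_ae ?_
    filter_upwards [hxy] with ω hω
    exact setLIntegral_congr_fun measurableSet_Ici fun t ht => by simp only [hω t ht]
  have hmeas : Measurable (Function.uncurry fun ω t => ENNReal.ofReal (‖y t ω‖ ^ 2)) :=
    ENNReal.measurable_ofReal.comp ((hy.comp measurable_swap).norm.pow_const 2)
  rw [hcongr, lintegral_lintegral_swap hmeas.aemeasurable]
  exact (setLIntegral_mono' measurableSet_Ici hbound).trans_lt hexp.lintegral_lt_top
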